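/- Call a group $G$ an FCI-group if $|C_G(x):\langle x\rangle|<\infty$ for every $x\in G$ such that the cyclic subgroup $\langle x\rangle$ is not normal in $G$. Call $G$ locally nilpotent if every finitely generated subgroup of $G$ is nilpotent. Let $G$ be a locally nilpotent FCI-group, and let $N$ be a normal subgroup of $G$. Then $G/N$ is an FCI-group. -/

import Mathlib

/-- A group is an FCI-group (finite centralizer index) if `|C_G(x) : ⟨x⟩| < ∞` for every `x`
such that the cyclic subgroup `⟨x⟩` is not normal in `G`. -/
def IsFCIGroup (G : Type*) [Group G] : Prop :=
  ∀ x : G, ¬ (Subgroup.zpowers x).Normal →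
    ((Subgroup.zpowers x).subgroupOf (Subgroup.centralizer {x})).FiniteIndex

/-- A group is locally nilpotent if all its finitely generated subgroups are nilpotent. -/
def IsLocallyNilpotentGroup (G : Type*) [Group G] : Prop :=
  ∀ H : Subgroup G, H.FG → Group.IsNilpotent H

open scoped commutatorElement

/-! If `⟨xN⟩` is not normal, neither is `⟨x⟩`, so `⟨x⟩` has finite index in `C(x)`; this finiteness
must pass to `G/N`. In a finitely generated, hence nilpotent, subgroup `H` containing `x`, it forces
`Z(H)` to have finite index, so `H'` is finite by Schur. With `M = N ∩ H` and `F = M ∩ H'`, passing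
to `H/M` enlarges the centralizer of `x` by a factor at most `|F|`, while adjoining `F` to `⟨x⟩`
regains `|F| / |F ∩ ⟨x⟩|`. The net loss `|F ∩ ⟨x⟩|` is bounded in terms of `x` alone, so the bound
is uniform in `H` and passes to `G/N`. -/

open Subgroup in
/-- A finitely generated nilpotent group with finite center is finite. -/
theorem finite_of_fg_of_finite_center {G : Type*} [Group G] [Group.IsNilpotent G]
    (hfg : Group.FG G) (hZ : Finite (center G)) : Finite G := by
  revert hfg hZ
  refine Group.nilpotent_center_quotient_ind
    (P := fun G _ _ => Group.FG G → Finite (center G) → Finite G) G ?_ ?_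
  · intro G _ _ _ _
    infer_instance
  · intro G _ _ ih hfg hZ
    obtain ⟨S, hS⟩ := Group.fg_def.1 hfg
    have hmem : ∀ (q : center (G ⧸ center G)) (s : S), ⁅q.1.out, (s : G)⁆ ∈ center G := by
      intro q s
      rw [← QuotientGroup.eq_one_iff, commutatorElement_def]
      rw [QuotientGroup.mk_mul, QuotientGroup.mk_mul, QuotientGroup.mk_mul, QuotientGroup.mk_inv,
        QuotientGroup.mk_inv, QuotientGroup.out_eq', ← mem_center_iff.1 q.2 (s : G)]
      group
    have hcen : ∀ g : G, (∀ s ∈ S, s * g = g * s) → g ∈ center G := by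
      intro g hg
      rw [← centralizer_univ, ← coe_top, ← hS, centralizer_closure, mem_centralizer_iff]
      exact hg
    -- An element of the second center is determined modulo `Z(G)` by its commutators with the
    -- generators.
    have hfin : Finite (center (G ⧸ center G)) := by
      refine Finite.of_injective
        (fun (q : center (G ⧸ center G)) (s : S) => (⟨_, hmem q s⟩ : center G)) ?_
      intro q r hqr
      apply Subtype.ext
      rw [← QuotientGroup.out_eq' q.1, ← QuotientGroup.out_eq' r.1, QuotientGroup.eq]
      refine hcen _ fun s hs => ?_
      have h := congrArg Subtype.val (congrFun hqr ⟨s, hs⟩)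
      simp only [commutatorElement_def] at h
      have h' := mul_right_cancel h
      calc s * (q.1.out⁻¹ * r.1.out)
          = q.1.out⁻¹ * (q.1.out * s * q.1.out⁻¹) * r.1.out := by group
        _ = q.1.out⁻¹ * r.1.out * s := by rw [h']; group
    have : Finite (G ⧸ center G) := ih inferInstance hfin
    exact Finite.of_equiv _ (groupEquivQuotientProdSubgroup (s := center G)).symm

open Subgroup in
/-- In a nilpotent group, an element normalizing an infinite cyclic subgroup centralizes it. -/
theorem commute_of_conj_mem_zpowers {G : Type*} [Group G] [Group.IsNilpotent G] {x g : G}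
    (hx : ¬ IsOfFinOrder x) (hg : g * x * g⁻¹ ∈ zpowers x) : Commute g x := by
  obtain ⟨m, hm⟩ := mem_zpowers_iff.1 hg
  -- With `g x g⁻¹ = x ^ m`, one has `⁅x ^ k, g⁆ = x ^ (k * (1 - m))`.
  have key : ∀ n : ℕ, x ^ ((1 - m) ^ n) ∈ (⊤ : Subgroup G).lowerCentralSeries n := by
    intro n
    induction n with
    | zero => simp
    | succ n ih =>
      have h := commutator_mem_commutator ih (mem_top g)
      rw [Subgroup.lowerCentralSeries_succ]
      convert h using 1
      rw [commutatorElement_def, mul_assoc, mul_assoc, ← mul_assoc g, ← zpow_neg, ← conj_zpow, ← hm,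
        ← zpow_mul, ← zpow_add]
      congr 1
      ring
  obtain ⟨n, hn⟩ := Subgroup.nilpotent_iff_lowerCentralSeries.1 ‹Group.IsNilpotent G›
  have h := key n
  rw [hn, mem_bot] at h
  have h0 : (1 - m) ^ n = 0 := by
    by_contra h0
    exact hx (isOfFinOrder_iff_zpow_eq_one.2 ⟨_, h0, h⟩)
  have h1 : m = 1 := by linarith [IsReduced.eq_zero _ ⟨n, h0⟩]
  rw [h1, zpow_one] at hm
  exact (eq_mul_inv_iff_mul_eq.1 hm).symm

open Subgroup in
/-- If `⟨x⟩` has finite index in the centralizer of `x` in a finitely generated nilpotent group,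
then the center of the group has finite index. -/
theorem finiteIndex_center_of_relIndex_zpowers_ne_zero {G : Type*} [Group G] [Group.IsNilpotent G]
    (hfg : Group.FG G) {x : G} (hx : (zpowers x).relIndex (centralizer {x}) ≠ 0) :
    (center G).FiniteIndex := by
  have hZ : (zpowers x).relIndex (center G) ≠ 0 :=
    relIndex_ne_zero_trans hx (fun h => by
      rw [relIndex_eq_one.2 (center_le_centralizer {x})] at h
      exact one_ne_zero h)
  by_cases hfin : Finite G
  · infer_instance
  -- Such a `K` would make the center, hence `G`, finite. `K = center G` yields `y`; `K = ⊥` yields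
  -- infinite order of `x`.
  have hinf : ∀ K : Subgroup G, K ⊓ zpowers x = ⊥ → K.relIndex (center G) ≠ 0 →
      False := by
    intro K hK hK'
    have h := relIndex_inf_ne_zero hK' hZ
    rw [hK, relIndex_bot_left] at h
    exact hfin (finite_of_fg_of_finite_center hfg (Nat.finite_of_card_ne_zero h))
  obtain ⟨y, ⟨hyZ, hyx⟩, hy1⟩ : ∃ y, y ∈ center G ⊓ zpowers x ∧ y ≠ 1 := by
    by_contra! h
    exact hinf _ ((eq_bot_iff_forall _).2 h) (by simp)
  have hxo : ¬ IsOfFinOrder x := by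
    intro h
    have : Finite (zpowers x) := finite_zpowers.2 h
    exact hinf ⊥ (by simp) (by
      rw [relIndex_bot_left]
      have h1 := relIndex_ne_zero_trans (H := ⊥) (by
        rw [relIndex_bot_left]; exact Nat.card_pos.ne') hZ
      rwa [relIndex_bot_left] at h1)
  have hKZ : zpowers y ≤ center G := zpowers_le.2 hyZ
  have : (zpowers y).Normal := ⟨fun z hz g => by
    rwa [mem_center_iff.1 (hKZ hz) g, mul_inv_cancel_right]⟩
  have hKx : (zpowers y).relIndex (zpowers x) ≠ 0 := by
    obtain ⟨j, rfl⟩ := mem_zpowers_iff.1 hyx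
    have h := Subgroup.relIndex_ker (f := QuotientGroup.mk' (zpowers (x ^ j))) (zpowers x)
    rw [QuotientGroup.ker_mk', MonoidHom.map_zpowers, Nat.card_zpowers] at h
    rw [h]
    refine (isOfFinOrder_iff_zpow_eq_one.2 ⟨j, ?_, ?_⟩).orderOf_pos.ne'
    · rintro rfl
      exact hy1 (zpow_zero x)
    · rw [← map_zpow, QuotientGroup.mk'_apply, QuotientGroup.eq_one_iff]
      exact mem_zpowers _
  -- Elements central modulo `⟨y⟩ ≤ ⟨x⟩` normalize `⟨x⟩`, hence centralize `x`.
  have hle : (center (G ⧸ zpowers y)).comap (QuotientGroup.mk' (zpowers y)) ≤ centralizer {x} := by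
    intro g hg
    rw [mem_centralizer_singleton_iff]
    have h := mem_center_iff.1 (mem_comap.1 hg) (QuotientGroup.mk' (zpowers y) x)
    refine commute_of_conj_mem_zpowers hxo ?_
    have h2 : g * x * g⁻¹ * x⁻¹ ∈ zpowers y := by
      rw [← QuotientGroup.eq_one_iff, ← QuotientGroup.mk'_apply, map_mul, map_mul, map_mul, ← h]
      simp
    have h3 := mul_mem (zpowers_le.2 hyx h2) (mem_zpowers x)
    rwa [inv_mul_cancel_right] at h3
  have hfinZ : Finite (center (G ⧸ zpowers y)) := by
    refine Nat.finite_of_card_ne_zero ?_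
    have h := Subgroup.relIndex_ker (f := QuotientGroup.mk' (zpowers y))
      ((center (G ⧸ zpowers y)).comap (QuotientGroup.mk' (zpowers y)))
    rw [QuotientGroup.ker_mk', map_comap_eq_self_of_surjective
      (QuotientGroup.mk'_surjective _)] at h
    rw [← h]
    exact fun h0 => relIndex_ne_zero_trans hKx hx (relIndex_eq_zero_of_le_right hle h0)
  have : Finite (G ⧸ zpowers y) := finite_of_fg_of_finite_center inferInstance hfinZ
  have : (zpowers y).FiniteIndex := finiteIndex_of_finite_quotient
  exact finiteIndex_of_le hKZ

open Subgroup in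
/-- Schur's theorem: if the center has finite index, then the commutator subgroup is finite. -/
theorem finite_commutator_of_finiteIndex_center {G : Type*} [Group G] [(center G).FiniteIndex] :
    Finite (_root_.commutator G) := by
  have : Finite (commutatorSet G) := by
    -- Commutators depend only on cosets of the center.
    refine Set.Finite.subset (Set.finite_range
      fun p : (G ⧸ center G) × (G ⧸ center G) => ⁅p.1.out, p.2.out⁆) ?_
    rintro _ ⟨a, b, rfl⟩
    refine ⟨(a, b), ?_⟩
    obtain ⟨z, hz⟩ := QuotientGroup.mk_out_eq_mul (center G) a
    obtain ⟨w, hw⟩ := QuotientGroup.mk_out_eq_mul (center G) b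
    have hz' := fun g => (mem_center_iff.1 z.2 g).symm
    have hw' := fun g => (mem_center_iff.1 w.2 g).symm
    simp only [hz, hw, commutatorElement_def, mul_inv_rev]
    calc a * z * (b * w) * ((z : G)⁻¹ * a⁻¹) * ((w : G)⁻¹ * b⁻¹)
        = a * (z * (b * w)) * (z : G)⁻¹ * a⁻¹ * (w : G)⁻¹ * b⁻¹ := by group
      _ = a * b * (w * a⁻¹) * (w : G)⁻¹ * b⁻¹ := by rw [hz']; group
      _ = a * b * a⁻¹ * b⁻¹ := by rw [hw']; group
  infer_instance

-- The map `d ↦ ⁅d⁻¹, x⁆` separates left cosets of `C(x)`.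
open Subgroup in
theorem relIndex_centralizer_le_card_inf_commutator {G : Type*} [Group G] (x : G) (M : Subgroup G)
    [M.Normal] [Finite (_root_.commutator G)] :
    (centralizer {x}).relIndex ((centralizer {(x : G ⧸ M)}).comap (QuotientGroup.mk' M)) ≠ 0 ∧
    (centralizer {x}).relIndex ((centralizer {(x : G ⧸ M)}).comap (QuotientGroup.mk' M)) ≤
      Nat.card (M ⊓ _root_.commutator G : Subgroup G) := by
  set D := (centralizer {(x : G ⧸ M)}).comap (QuotientGroup.mk' M) with hD
  have hfin : Finite (M ⊓ _root_.commutator G : Subgroup G) :=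
    Set.Finite.subset (s := (_root_.commutator G : Set G)) (Set.toFinite _) fun _ h => h.2
  have hmem : ∀ d : D, ⁅(d : G)⁻¹, x⁆ ∈ M ⊓ _root_.commutator G := by
    intro d
    refine ⟨?_, commutator_mem_commutator (mem_top _) (mem_top _)⟩
    have h := mem_centralizer_singleton_iff.1 (mem_comap.1 (inv_mem d.2))
    change _ ∈ M
    rw [← QuotientGroup.eq_one_iff, ← QuotientGroup.mk'_apply,
      map_commutatorElement]
    exact commutatorElement_eq_one_iff_mul_comm.2 h
  let f : D ⧸ (centralizer {x}).subgroupOf D → (M ⊓ _root_.commutator G : Subgroup G) :=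
    fun q => ⟨_, hmem q.out⁻¹⟩
  have hf : Function.Injective f := by
    intro q r hqr
    have h := congrArg Subtype.val hqr
    simp only [f, commutatorElement_def, coe_inv, inv_inv] at h
    have h' := mul_right_cancel h
    rw [← QuotientGroup.out_eq' q, ← QuotientGroup.out_eq' r, QuotientGroup.eq, mem_subgroupOf,
      mem_centralizer_singleton_iff]
    push_cast
    calc (q.out : G)⁻¹ * r.out * x = (q.out : G)⁻¹ * (r.out * x * (r.out : G)⁻¹) * r.out := by group
      _ = x * ((q.out : G)⁻¹ * r.out) := by rw [← h']; group
  have : Finite (D ⧸ (centralizer {x}).subgroupOf D) := Finite.of_injective f hf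
  exact ⟨(finiteIndex_of_finite_quotient (H := (centralizer {x}).subgroupOf D)).index_ne_zero,
    Nat.card_le_card_of_injective f hf⟩

-- The `max` covers infinite order, where `orderOf x = 0` and `K` is trivial.
open Subgroup in
theorem card_le_of_le_zpowers {G : Type*} [Group G] {x : G} {K : Subgroup G} [Finite K]
    (hK : K ≤ zpowers x) : Nat.card K ≤ max (orderOf x) 1 := by
  by_cases hx : IsOfFinOrder x
  · have : Finite (zpowers x) := finite_zpowers.2 hx
    rw [← Nat.card_zpowers]
    exact (card_le_of_le hK).trans (le_max_left _ _)
  · have : K = ⊥ := by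
      rw [eq_bot_iff_forall]
      intro y hy
      obtain ⟨j, rfl⟩ := mem_zpowers_iff.1 (hK hy)
      by_contra hne
      obtain ⟨n, hn, h⟩ := isOfFinOrder_iff_pow_eq_one.1
        ((Submonoid.isOfFinOrder_coe (H := K.toSubmonoid)).2 (isOfFinOrder_of_finite (⟨_, hy⟩ : K)))
      refine hx (isOfFinOrder_iff_zpow_eq_one.2 ⟨j * n, mul_ne_zero ?_ (by exact_mod_cast hn.ne'), ?_⟩)
      · rintro rfl
        exact hne (zpow_zero x)
      · rw [zpow_mul, zpow_natCast]
        exact h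
    simp [this]

open Subgroup in
/-- The index of `⟨x⟩` in the centralizer of `x` controls the corresponding index in quotients. -/
theorem relIndex_sup_zpowers_le {G : Type*} [Group G] (x : G) (M : Subgroup G)
    [M.Normal] [Finite (_root_.commutator G)] (hx : (zpowers x).relIndex (centralizer {x}) ≠ 0) :
    (M ⊔ zpowers x).relIndex ((centralizer {(x : G ⧸ M)}).comap (QuotientGroup.mk' M)) ≠ 0 ∧
    (M ⊔ zpowers x).relIndex ((centralizer {(x : G ⧸ M)}).comap (QuotientGroup.mk' M)) ≤
      (zpowers x).relIndex (centralizer {x}) * max (orderOf x) 1 := by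
  obtain ⟨h0, hle⟩ := relIndex_centralizer_le_card_inf_commutator x M
  set D := (centralizer {(x : G ⧸ M)}).comap (QuotientGroup.mk' M) with hD
  set F : Subgroup G := M ⊓ _root_.commutator G with hF
  have hfin : Finite F :=
    Set.Finite.subset (s := (_root_.commutator G : Set G)) (Set.toFinite _) fun _ h => h.2
  have hCD : centralizer {x} ≤ D := by
    intro g hg
    rw [mem_centralizer_singleton_iff] at hg
    rw [hD, mem_comap, mem_centralizer_singleton_iff, QuotientGroup.mk'_apply,
      ← QuotientGroup.mk_mul, hg, QuotientGroup.mk_mul]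
  have hxC : zpowers x ≤ centralizer {x} := by
    rw [zpowers_le, mem_centralizer_singleton_iff]
  have hMD : M ≤ D := by
    intro g hg
    rw [hD, mem_comap, QuotientGroup.mk'_apply, (QuotientGroup.eq_one_iff g).2 hg]
    exact one_mem _
  have hFD : F ⊔ zpowers x ≤ D := sup_le (inf_le_left.trans hMD) (hxC.trans hCD)
  have h1 := relIndex_mul_relIndex (zpowers x) (centralizer {x}) D hxC hCD
  have h2 := relIndex_mul_relIndex (zpowers x) (F ⊔ zpowers x) D le_sup_right hFD
  have hx0 : (zpowers x).relIndex (F ⊔ zpowers x) ≠ 0 := by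
    intro h
    rw [h, zero_mul, ← h1] at h2
    exact mul_ne_zero hx h0 h2.symm
  have h3 : Nat.card F ≤
      (zpowers x).relIndex (F ⊔ zpowers x) * Nat.card (F ⊓ zpowers x : Subgroup G) := by
    have h := relIndex_mul_relIndex ⊥ (F ⊓ zpowers x) F bot_le inf_le_left
    rw [relIndex_bot_left, relIndex_bot_left, inf_relIndex_left] at h
    rw [← h, mul_comm]
    exact Nat.mul_le_mul_right _ (relIndex_le_of_le_right le_sup_left hx0)
  have hFM : F ⊔ zpowers x ≤ M ⊔ zpowers x := sup_le_sup_right inf_le_left _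
  have h4 : (F ⊔ zpowers x).relIndex D ≠ 0 := by
    intro h
    rw [h, mul_zero, ← h1] at h2
    exact mul_ne_zero hx h0 h2.symm
  refine ⟨fun h => h4 (relIndex_eq_zero_of_le_left hFM h),
    (relIndex_le_of_le_left hFM h4).trans ?_⟩
  have : Finite (F ⊓ zpowers x : Subgroup G) :=
    Set.Finite.subset (s := (F : Set G)) (Set.toFinite _) fun _ h => h.1
  have h5 := card_le_of_le_zpowers (x := x) (K := F ⊓ zpowers x) inf_le_right
  have hpos : 0 < Nat.card F := Nat.card_pos
  refine Nat.le_of_mul_le_mul_left ?_ hpos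
  calc Nat.card F * (F ⊔ zpowers x).relIndex D
      ≤ ((zpowers x).relIndex (F ⊔ zpowers x) * Nat.card (F ⊓ zpowers x : Subgroup G))
          * (F ⊔ zpowers x).relIndex D := Nat.mul_le_mul_right _ h3
    _ = ((zpowers x).relIndex (F ⊔ zpowers x) * (F ⊔ zpowers x).relIndex D)
          * Nat.card (F ⊓ zpowers x : Subgroup G) := by ring
    _ = ((zpowers x).relIndex (centralizer {x}) * (centralizer {x}).relIndex D)
          * Nat.card (F ⊓ zpowers x : Subgroup G) := by rw [h2, h1]
    _ ≤ ((zpowers x).relIndex (centralizer {x}) * Nat.card F) * max (orderOf x) 1 := by gcongr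
    _ = _ := by ring

-- Were the index infinite, `B + 1` coset representatives together with `x` would generate an `H`
-- violating the uniform bound `B`.
open Subgroup in
theorem relIndex_zpowers_quotient_ne_zero {G : Type*} [Group G] (hnil : IsLocallyNilpotentGroup G)
    {x : G} (hx : (zpowers x).relIndex (centralizer {x}) ≠ 0) (N : Subgroup G) [N.Normal] :
    (zpowers (x : G ⧸ N)).relIndex (centralizer {(x : G ⧸ N)}) ≠ 0 := by
  intro hzero
  have hinf : Infinite (centralizer {(x : G ⧸ N)} ⧸
      (zpowers (x : G ⧸ N)).subgroupOf (centralizer {(x : G ⧸ N)})) := by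
    by_contra h
    rw [not_infinite_iff_finite] at h
    exact (finiteIndex_of_finite_quotient (H := (zpowers (x : G ⧸ N)).subgroupOf
      (centralizer {(x : G ⧸ N)}))).index_ne_zero hzero
  set B := (zpowers x).relIndex (centralizer {x}) * max (orderOf x) 1
  obtain ⟨e⟩ : Nonempty (Fin (B + 1) ↪ (centralizer {(x : G ⧸ N)} ⧸
      (zpowers (x : G ⧸ N)).subgroupOf (centralizer {(x : G ⧸ N)}))) :=
    ⟨Fin.valEmbedding.trans (Infinite.natEmbedding _)⟩
  let g : Fin (B + 1) → G := fun i => (e i).out.1.out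
  have hg : ∀ i, (g i : G ⧸ N) = (e i).out.1 := fun i => QuotientGroup.out_eq' _
  let H : Subgroup G := closure (insert x (Set.range g))
  have hxH : x ∈ H := subset_closure (Set.mem_insert _ _)
  have hgH : ∀ i, g i ∈ H := fun i => subset_closure (Set.mem_insert_of_mem _ ⟨i, rfl⟩)
  have hHfg : H.FG := (fg_iff H).2 ⟨_, rfl, (Set.finite_range g).insert x⟩
  have : Group.IsNilpotent H := hnil H hHfg
  let y : H := ⟨x, hxH⟩
  have hzy : zpowers y = (zpowers x).subgroupOf H := by
    refine map_injective H.subtype_injective ?_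
    rw [MonoidHom.map_zpowers, subgroupOf_map_subtype, inf_eq_left.2 (zpowers_le.2 hxH)]
    rfl
  have hcy : centralizer {y} = (centralizer {x}).subgroupOf H := by
    ext h
    rw [mem_subgroupOf, mem_centralizer_singleton_iff, mem_centralizer_singleton_iff,
      Subtype.ext_iff]
    rfl
  have hrel : (zpowers y).relIndex (centralizer {y}) =
      (zpowers x).relIndex (centralizer {x} ⊓ H) := by
    rw [hzy, hcy, ← relIndex_subgroupOf (inf_le_right : centralizer {x} ⊓ H ≤ H),
      inf_subgroupOf_right]
  have hrel0 : (zpowers y).relIndex (centralizer {y}) ≠ 0 := by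
    rw [hrel]
    exact fun h => hx (relIndex_eq_zero_of_le_right inf_le_left h)
  have hrelle : (zpowers y).relIndex (centralizer {y}) ≤ (zpowers x).relIndex (centralizer {x}) := by
    rw [hrel]
    exact relIndex_le_of_le_right inf_le_left hx
  have := finiteIndex_center_of_relIndex_zpowers_ne_zero ((Group.fg_iff_subgroup_fg H).2 hHfg) hrel0
  have : Finite (_root_.commutator H) := finite_commutator_of_finiteIndex_center
  obtain ⟨h0, hle⟩ := relIndex_sup_zpowers_le y (N.subgroupOf H) hrel0
  set D := (centralizer {(y : H ⧸ N.subgroupOf H)}).comap (QuotientGroup.mk' (N.subgroupOf H))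
  have hgD : ∀ i, (⟨g i, hgH i⟩ : H) ∈ D := by
    intro i
    rw [mem_comap, mem_centralizer_singleton_iff, QuotientGroup.mk'_apply, ← QuotientGroup.mk_mul,
      ← QuotientGroup.mk_mul, QuotientGroup.eq, mem_subgroupOf]
    push_cast
    rw [← QuotientGroup.eq, QuotientGroup.mk_mul, QuotientGroup.mk_mul, hg]
    exact mem_centralizer_singleton_iff.1 (e i).out.2
  have hsup : N.subgroupOf H ⊔ zpowers y ≤
      (zpowers (x : G ⧸ N)).comap ((QuotientGroup.mk' N).comp H.subtype) := by
    refine sup_le ?_ ?_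
    · intro h hh
      have h1 : ((h : G) : G ⧸ N) = 1 := (QuotientGroup.eq_one_iff _).2 (mem_subgroupOf.1 hh)
      rw [mem_comap, MonoidHom.comp_apply, QuotientGroup.mk'_apply, coe_subtype, h1]
      exact one_mem _
    · rw [zpowers_le]
      exact mem_zpowers _
  have hfinq : Finite (D ⧸ (N.subgroupOf H ⊔ zpowers y).subgroupOf D) :=
    Nat.finite_of_card_ne_zero h0
  let φ : Fin (B + 1) → D ⧸ (N.subgroupOf H ⊔ zpowers y).subgroupOf D :=
    fun i => ((⟨⟨g i, hgH i⟩, hgD i⟩ : D) : D ⧸ (N.subgroupOf H ⊔ zpowers y).subgroupOf D)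
  have hφ : Function.Injective φ := by
    intro i j hij
    have h := hsup (mem_subgroupOf.1 (QuotientGroup.eq.1 hij))
    apply e.injective
    rw [← QuotientGroup.out_eq' (e i), ← QuotientGroup.out_eq' (e j), QuotientGroup.eq,
      mem_subgroupOf]
    push_cast
    rw [← hg, ← hg]
    exact h
  have hcard := Nat.card_le_card_of_injective φ hφ
  rw [Nat.card_fin] at hcard
  have hord : orderOf y = orderOf x := (orderOf_coe y).symm
  rw [hord] at hle
  have := (hcard.trans hle).trans (Nat.mul_le_mul_right _ hrelle)
  omega

theorem proposition3p3 {G : Type*} [Group G] (hnil : IsLocallyNilpotentGroup G)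
    (hFCI : IsFCIGroup G) (N : Subgroup G) [N.Normal] : IsFCIGroup (G ⧸ N) := by
  intro q hq
  obtain ⟨x, rfl⟩ := QuotientGroup.mk_surjective q
  have hx : ¬ (Subgroup.zpowers x).Normal := by
    intro h
    apply hq
    have := h.map (QuotientGroup.mk' N) (QuotientGroup.mk'_surjective N)
    rwa [MonoidHom.map_zpowers] at this
  exact ⟨relIndex_zpowers_quotient_ne_zero hnil (hFCI x hx).index_ne_zero N⟩
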